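/- A left brace is a set $B$ with two operations $+$ and $\circ$ such that $(B,+)$ is an abelian group, $(B,\circ)$ is a group and $a\circ(b+c)+a=a\circ b+a\circ c$ for all $a,b,c\in B$. Its lambda map is $\lambda_a(b)=-a+a\circ b$, which defines an action of $(B,\circ)$ on $(B,+)$ by automorphisms. An ideal of $B$ is a normal subgroup $I$ of $(B,\circ)$ with $\lambda_a(I)\subseteq I$ for all $a\in B$, and $B$ is simple if $B\neq\{0\}$ and $\{0\}$ and $B$ are its only ideals. For $X\subseteq B$, let $\langle X\rangle_+$ be the subgroup of $(B,+)$ generated by $X$. There exists a finite simple left brace $B$ such that $\langle X\rangle_+\neq B$ for the orbit $X$ of every element of $B$ under the action of the lambda map. More precisely, let $p_1\neq p_2$ be primes with $p_2>2$. Put $V_1=(\mathbb{Z}/p_1)^{p_2-1}$, $V_2=(\mathbb{Z}/p_2)^{p_1-1}$ (row vectors), $T=V_1\times V_1\times V_2$ and $H=\mathbb{Z}/p_1\times\mathbb{Z}/p_2$. Let $C_1\in M_{p_2-1}(\mathbb{Z}/p_1)$ and $C_2\in M_{p_1-1}(\mathbb{Z}/p_2)$ be the matrices whose last column has all entries $-1$,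 and whose other columns have the entry $1$ immediately below the diagonal and $0$ elsewhere. Let $B_1\in M_{p_2-1}(\mathbb{Z}/p_1)$ (respectively $B_2\in M_{p_1-1}(\mathbb{Z}/p_2)$) be the matrix with all diagonal entries equal to $1-p_2$ (respectively $1-p_1$) and all other entries equal to $1$. For $x=(x_1,x_2)\in H$ and $u=(u_{1,1},u_{1,2},u_2)$, $v=(v_{1,1},v_{1,2},v_2)\in T$ put $$\alpha(x)(u)=\bigl(u_{1,1}(C_1^{x_2})^t,\;u_{1,2}(C_1^{x_2})^t,\;u_2(C_2^{x_1})^t\bigr),$$ $$b(u,v)=\bigl(u_{1,1}B_1v_{1,1}^t+u_{1,2}B_1v_{1,2}^t,\;u_2B_2v_2^t\bigr).$$ Then $T\times H$ with the operations $$(u,x)+(v,y)=(u+v,\;x+y+b(u,v)),\qquad (u,x)\circ(v,y)=(u+\alpha(x)(v),\;x+y)$$ (the asymmetric product $T\rtimes_\circ H$ of the trivial braces $T$ and $H$ via $\alpha$ and $b$) is a finite simple left brace $B$ such that $\langle X\rangle_+\neq B$ for the orbit $X$ of every element of $B$ under the action of the lambda map. -/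

import Mathlib

open scoped Matrix

/-- A left brace: an abelian group `(B, +)` and a group `(B, *)` on the same set such that
`a * (b + c) + a = a * b + a * c`. -/
class LeftBrace (B : Type*) extends AddCommGroup B, Group B where
  brace_eq : ∀ a b c : B, a * (b + c) + a = a * b + a * c

namespace LeftBrace

variable {B : Type*} [LeftBrace B]

/-- The lambda map `λ_a(b) = -a + a * b`. -/
def lam (a b : B) : B := -a + a * b

/-- The orbit of `x` under the action of the lambda map. -/
def orbit (x : B) : Set B := {y | ∃ a : B, lam a x = y}

/-- An ideal: a normal subgroup of the multiplicative group, stable under every `λ_a`. -/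
def IsIdeal (I : Subgroup B) : Prop :=
  I.Normal ∧ ∀ a b : B, b ∈ I → lam a b ∈ I

/-- A left brace is simple if it is non-zero and has no ideals but the two obvious ones. -/
def IsSimple (B : Type*) [LeftBrace B] : Prop :=
  Nontrivial B ∧ ∀ I : Subgroup B, IsIdeal I → I = ⊥ ∨ I = ⊤

end LeftBrace

/-- The data of an asymmetric product of the trivial braces on the abelian groups `T` and `H`:
an action `α` of `H` on `T` (addition in `AddAut T` is composition) and an `α`-invariant symmetric bilinear map `b : T × T → H`. -/
structure AsymData (T H : Type*) [AddCommGroup T] [AddCommGroup H] where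
  α : H →+ AddAut T
  b : T →+ T →+ H
  symm : ∀ u v : T, b u v = b v u
  inv : ∀ (x : H) (u v : T), b (α x u) (α x v) = b u v

/-- The underlying set `T × H` of the asymmetric product. -/
@[ext]
structure AsymProd {T H : Type*} [AddCommGroup T] [AddCommGroup H] (D : AsymData T H) where
  fst : T
  snd : H

namespace AsymProd

variable {T H : Type*} [AddCommGroup T] [AddCommGroup H] {D : AsymData T H}

/-- `(u, x) + (v, y) = (u + v, x + y + b(u, v))`. -/
instance : Add (AsymProd D) := ⟨fun p q => ⟨p.fst + q.fst, p.snd + q.snd + D.b p.fst q.fst⟩⟩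

instance : Zero (AsymProd D) := ⟨⟨0, 0⟩⟩

instance : Neg (AsymProd D) := ⟨fun p => ⟨-p.fst, -p.snd + D.b p.fst p.fst⟩⟩

/-- `(u, x) * (v, y) = (u + α(x)(v), x + y)`. -/
instance : Mul (AsymProd D) :=
  ⟨fun p q => ⟨p.fst + D.α p.snd q.fst, p.snd + q.snd⟩⟩

instance : One (AsymProd D) := ⟨⟨0, 0⟩⟩

instance : Inv (AsymProd D) :=
  ⟨fun p => ⟨-D.α (-p.snd) p.fst, -p.snd⟩⟩

theorem add_def (p q : AsymProd D) :
    p + q = ⟨p.fst + q.fst, p.snd + q.snd + D.b p.fst q.fst⟩ := rfl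

theorem zero_def : (0 : AsymProd D) = ⟨0, 0⟩ := rfl

theorem neg_def (p : AsymProd D) : -p = ⟨-p.fst, -p.snd + D.b p.fst p.fst⟩ := rfl

theorem mul_def (p q : AsymProd D) :
    p * q = ⟨p.fst + D.α p.snd q.fst, p.snd + q.snd⟩ := rfl

theorem one_def : (1 : AsymProd D) = ⟨0, 0⟩ := rfl

theorem inv_def (p : AsymProd D) :
    p⁻¹ = ⟨-D.α (-p.snd) p.fst, -p.snd⟩ := rfl

instance : AddCommGroup (AsymProd D) where
  add_assoc p q r := by
    simp only [add_def, map_add, AddMonoidHom.add_apply, AsymProd.mk.injEq]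
    constructor <;> abel
  zero_add p := by simp [add_def, zero_def]
  add_zero p := by simp [add_def, zero_def]
  add_comm p q := by
    simp only [add_def, AsymProd.mk.injEq, D.symm q.fst p.fst]
    constructor <;> abel
  neg_add_cancel p := by
    simp [add_def, zero_def, neg_def]
  nsmul := nsmulRec
  zsmul := zsmulRec

instance : Group (AsymProd D) where
  mul_assoc p q r := by
    simp [mul_def, add_assoc]
  one_mul p := by simp [mul_def, one_def]
  mul_one p := by simp [mul_def, one_def]
  inv_mul_cancel p := by
    simp [mul_def, one_def, inv_def]

/-- The asymmetric product of the trivial braces `T` and `H`. -/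
instance : LeftBrace (AsymProd D) where
  brace_eq p q r := by
    have h := D.inv p.snd q.fst r.fst
    simp only [add_def, mul_def, map_add, AddMonoidHom.add_apply, AsymProd.mk.injEq, h]
    constructor
    · abel
    · rw [D.symm p.fst (D.α _ r.fst)]; abel

end AsymProd

section Matrices

variable (n : ℕ) (R : Type*) [CommRing R]

/-- The companion matrix of `1 + t + ⋯ + t ^ n`: ones below the diagonal, last column `-1`. -/
def cMat : Matrix (Fin n) (Fin n) R :=
  Matrix.of fun i j => if (j : ℕ) + 1 = n then -1 else if (i : ℕ) = j + 1 then 1 else 0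

/-- The matrix with diagonal entries `1 - (n + 1) = -n` and all other entries `1`. -/
def bMat : Matrix (Fin n) (Fin n) R :=
  Matrix.of fun i j => if i = j then 1 - ((n : R) + 1) else 1

/-- The cyclic sequence `e_0, …, e_{n-1}, -(e_0 + ⋯ + e_{n-1}), e_0, …`. -/
def cycVec (m : ℕ) : Fin n → R := fun i =>
  (if (i : ℕ) = m % (n + 1) then 1 else 0) - (if n = m % (n + 1) then 1 else 0)

variable {n} {R}

theorem cMat_mulVec (v : Fin n → R) (i : Fin n) :
    (cMat n R *ᵥ v) i = (if h : (i : ℕ) = 0 then 0 else v ⟨i - 1, by omega⟩)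
      - v ⟨n - 1, by have := i.2; omega⟩ := by
  have key : ∀ j : Fin n, cMat n R i j * v j
      = (if (i : ℕ) = j + 1 then v j else 0) - (if (j : ℕ) + 1 = n then v j else 0) := by
    intro j
    have hi := i.2
    simp only [cMat, Matrix.of_apply]
    split_ifs <;> first | omega | simp
  have hlast : ∑ j : Fin n, (if (j : ℕ) + 1 = n then v j else 0)
      = v ⟨n - 1, by have := i.2; omega⟩ := by
    rw [Finset.sum_eq_single ⟨n - 1, by have := i.2; omega⟩]
    · rw [if_pos]; have := i.2; simp only; omega
    · intro j _ hj
      rw [if_neg]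
      intro h
      apply hj
      ext
      simp only
      omega
    · simp
  rw [Matrix.mulVec, dotProduct, Finset.sum_congr rfl fun j _ => key j, Finset.sum_sub_distrib,
    hlast]
  congr 1
  split_ifs with h
  · apply Finset.sum_eq_zero
    intro j _
    rw [if_neg (by omega)]
  · rw [Finset.sum_eq_single ⟨i - 1, by omega⟩]
    · rw [if_pos]; simp only; omega
    · intro j _ hj
      rw [if_neg]
      intro h
      apply hj
      ext
      simp only
      omega
    · simp

theorem cMat_mulVec_cycVec (m : ℕ) : cMat n R *ᵥ cycVec n R m = cycVec n R (m + 1) := by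
  ext i
  have hi := i.2
  have hm : m % (n + 1) < n + 1 := Nat.mod_lt _ (by omega)
  have h1 : (m + 1) % (n + 1) = if m % (n + 1) = n then 0 else m % (n + 1) + 1 := by
    rw [Nat.add_mod]
    split_ifs with h
    · rw [h]; rcases n with _ | n
      · omega
      · simp
    · rw [Nat.mod_eq_of_lt (a := 1) (by omega), Nat.mod_eq_of_lt (by omega)]
  rw [cMat_mulVec]
  simp only [cycVec, h1]
  generalize m % (n + 1) = r at *
  split_ifs <;> first | omega | simp

theorem cMat_pow_mulVec_cycVec (k m : ℕ) :
    cMat n R ^ k *ᵥ cycVec n R m = cycVec n R (m + k) := by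
  induction k generalizing m with
  | zero => simp
  | succ k ih => rw [pow_succ, ← Matrix.mulVec_mulVec, cMat_mulVec_cycVec, ih]; congr 1; omega

theorem cycVec_fin (j : Fin n) : cycVec n R j = Pi.single j 1 := by
  ext i
  have hj := j.2
  rw [cycVec, Nat.mod_eq_of_lt (by omega), if_neg (by omega : ¬ n = (j : ℕ)), Pi.single_apply]
  simp [Fin.ext_iff]

theorem cMat_pow_succ : cMat n R ^ (n + 1) = 1 := by
  apply Matrix.ext_of_mulVec_single
  intro j
  rw [← cycVec_fin, cMat_pow_mulVec_cycVec, Matrix.one_mulVec]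
  ext i
  simp [cycVec]

theorem bMat_cycVec (r s : ℕ) :
    cycVec n R r ⬝ᵥ (bMat n R *ᵥ cycVec n R s) =
      if r % (n + 1) = s % (n + 1) then 1 - ((n : R) + 1) else 1 := by
  have hB : ∀ v : Fin n → R, bMat n R *ᵥ v = fun i => ∑ j, v j - ((n : R) + 1) * v i := by
    intro v
    ext i
    have key : ∀ j : Fin n, bMat n R i j * v j
        = v j - (if i = j then ((n : R) + 1) * v j else 0) := by
      intro j
      simp only [bMat, Matrix.of_apply]
      split_ifs <;> ring
    rw [Matrix.mulVec, dotProduct, Finset.sum_congr rfl fun j _ => key j, Finset.sum_sub_distrib]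
    simp
  have hr : r % (n + 1) < n + 1 := Nat.mod_lt _ (by omega)
  have hs : s % (n + 1) < n + 1 := Nat.mod_lt _ (by omega)
  have hv : ∀ m : ℕ, (m % (n + 1) = n ∧ cycVec n R m = fun _ => -1) ∨
      ∃ j : Fin n, m % (n + 1) = j ∧ cycVec n R m = Pi.single j 1 := by
    intro m
    have hm : m % (n + 1) < n + 1 := Nat.mod_lt _ (by omega)
    by_cases h : m % (n + 1) = n
    · left
      refine ⟨h, ?_⟩
      ext i
      have := i.2
      rw [cycVec, h, if_neg (by omega), if_pos rfl]
      simp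
    · right
      refine ⟨⟨m % (n + 1), by omega⟩, rfl, ?_⟩
      rw [← cycVec_fin]
      ext i
      simp [cycVec]
  rw [hB]
  rcases hv r with ⟨h1, h1'⟩ | ⟨i, h1, h1'⟩ <;> rcases hv s with ⟨h2, h2'⟩ | ⟨j, h2, h2'⟩ <;>
    rw [h1, h2, h1', h2']
  · simp [dotProduct]
  · have := j.2
    rw [if_neg (by omega)]
    simp [dotProduct, ← Finset.mul_sum]
  · have := i.2
    rw [if_neg (by omega)]
    simp
  · rw [single_one_dotProduct, Finset.sum_pi_single', if_pos (Finset.mem_univ j), Pi.single_apply]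
    simp only [Fin.ext_iff]
    split_ifs <;> ring

theorem cMat_bMat : (cMat n R)ᵀ * bMat n R * cMat n R = bMat n R := by
  ext i j
  have h := bMat_cycVec (n := n) (R := R) (i + 1) (j + 1)
  have e : ((cMat n R)ᵀ * bMat n R * cMat n R) i j = cycVec n R (i + 1) ⬝ᵥ
      (bMat n R *ᵥ cycVec n R (j + 1)) := by
    rw [← cMat_mulVec_cycVec, ← cMat_mulVec_cycVec, cycVec_fin, cycVec_fin, Matrix.mulVec_mulVec,
      Matrix.dotProduct_mulVec]
    rw [← Matrix.vecMul_transpose, Matrix.vecMul_vecMul, ← Matrix.mul_assoc,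
      ← Matrix.dotProduct_mulVec, Matrix.mulVec_single_one, single_one_dotProduct]
    rfl
  rw [e, h]
  have hi := i.2
  have hj := j.2
  rw [Nat.mod_eq_of_lt (by omega), Nat.mod_eq_of_lt (by omega)]
  simp [bMat, Fin.ext_iff]

theorem bMat_symm : (bMat n R)ᵀ = bMat n R := by
  ext i j
  simp [bMat, eq_comm]

theorem cMat_pow_bMat (k : ℕ) : (cMat n R ^ k)ᵀ * bMat n R * cMat n R ^ k = bMat n R := by
  induction k with
  | zero => simp
  | succ k ih =>
    rw [pow_succ, Matrix.transpose_mul]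
    calc _ = (cMat n R)ᵀ * ((cMat n R ^ k)ᵀ * bMat n R * cMat n R ^ k) * cMat n R := by
          simp only [Matrix.mul_assoc]
      _ = _ := by rw [ih, cMat_bMat]

theorem cMat_pow_val_add (q : ℕ) [NeZero q] (x y : ZMod q) :
    cMat (q - 1) R ^ (x + y).val = cMat (q - 1) R ^ x.val * cMat (q - 1) R ^ y.val := by
  have h : cMat (q - 1) R ^ q = 1 := by
    have := cMat_pow_succ (n := q - 1) (R := R)
    rwa [Nat.sub_add_cancel (NeZero.one_le : 1 ≤ q)] at this
  rw [ZMod.val_add, ← pow_add]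
  conv_rhs => rw [← Nat.mod_add_div (x.val + y.val) q, pow_add, pow_mul, h, one_pow, mul_one]

variable (R)

/-- The action `x ↦ (u ↦ u (C ^ x)ᵗ)` of `ℤ/q` on row vectors of length `q - 1`. -/
def cycAct (q : ℕ) [NeZero q] : ZMod q →+ AddAut (Fin (q - 1) → R) where
  toFun x :=
    { toFun := fun u => u ᵥ* (cMat (q - 1) R ^ x.val)ᵀ
      invFun := fun u => u ᵥ* (cMat (q - 1) R ^ (-x).val)ᵀ
      left_inv := fun u => by
        simp only [Matrix.vecMul_transpose, Matrix.mulVec_mulVec, ← cMat_pow_val_add]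
        simp
      right_inv := fun u => by
        simp only [Matrix.vecMul_transpose, Matrix.mulVec_mulVec, ← cMat_pow_val_add]
        simp
      map_add' := fun u v => Matrix.add_vecMul _ u v }
  map_zero' := by
    ext u i
    simp
  map_add' x y := by
    ext u i
    simp [cMat_pow_val_add]

/-- The bilinear form `(u, v) ↦ u B vᵗ` on row vectors of length `n`. -/
def cycForm (n : ℕ) : (Fin n → R) →+ (Fin n → R) →+ R :=
  AddMonoidHom.mk' (fun u => AddMonoidHom.mk' (fun v => u ᵥ* bMat n R ⬝ᵥ v)
    fun v w => dotProduct_add _ v w) fun u v => by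
      ext w
      simp [Matrix.add_vecMul]

theorem cycForm_apply (u v : Fin n → R) : cycForm R n u v = u ᵥ* bMat n R ⬝ᵥ v := rfl

theorem cycForm_symm (u v : Fin n → R) : cycForm R n u v = cycForm R n v u := by
  rw [cycForm_apply, cycForm_apply, dotProduct_comm, ← Matrix.mulVec_transpose, bMat_symm,
    Matrix.dotProduct_mulVec]

theorem cycForm_cycAct (q : ℕ) [NeZero q] (x : ZMod q) (u v : Fin (q - 1) → R) :
    cycForm R (q - 1) (cycAct R q x u) (cycAct R q x v) = cycForm R (q - 1) u v := by
  change (u ᵥ* (cMat (q - 1) R ^ x.val)ᵀ) ᵥ* bMat (q - 1) R ⬝ᵥ (v ᵥ* (cMat (q - 1) R ^ x.val)ᵀ)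
    = u ᵥ* bMat (q - 1) R ⬝ᵥ v
  rw [Matrix.vecMul_transpose _ v, Matrix.dotProduct_mulVec, Matrix.vecMul_vecMul,
    Matrix.vecMul_vecMul, ← Matrix.mul_assoc, cMat_pow_bMat]

end Matrices

/-- `T = V₁² × V₂` with `V₁ = (ℤ/p₁)^(p₂ - 1)` and `V₂ = (ℤ/p₂)^(p₁ - 1)`. -/
abbrev TGroup (p₁ p₂ : ℕ) : Type :=
  ((Fin (p₂ - 1) → ZMod p₁) × (Fin (p₂ - 1) → ZMod p₁)) × (Fin (p₁ - 1) → ZMod p₂)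

/-- `H = ℤ/p₁ × ℤ/p₂`. -/
abbrev HGroup (p₁ p₂ : ℕ) : Type := ZMod p₁ × ZMod p₂

/-- `α(x₁, x₂)(u₁₁, u₁₂, u₂) = (u₁₁ (C₁ ^ x₂)ᵗ, u₁₂ (C₁ ^ x₂)ᵗ, u₂ (C₂ ^ x₁)ᵗ)` and
`b((u₁₁, u₁₂, u₂), (v₁₁, v₁₂, v₂)) = (u₁₁ B₁ v₁₁ᵗ + u₁₂ B₁ v₁₂ᵗ, u₂ B₂ v₂ᵗ)`. -/
def asymData (p₁ p₂ : ℕ) [NeZero p₁] [NeZero p₂] : AsymData (TGroup p₁ p₂) (HGroup p₁ p₂) where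
  α :=
    { toFun := fun x =>
        ((cycAct (ZMod p₁) p₂ x.2).prodCongr (cycAct (ZMod p₁) p₂ x.2)).prodCongr
          (cycAct (ZMod p₂) p₁ x.1)
      map_zero' := by simp only [Prod.fst_zero, Prod.snd_zero, map_zero]; rfl
      map_add' := fun x y => by simp only [Prod.fst_add, Prod.snd_add, map_add]; rfl }
  b := AddMonoidHom.mk' (fun u => AddMonoidHom.mk' (fun v =>
      (cycForm (ZMod p₁) (p₂ - 1) u.1.1 v.1.1 + cycForm (ZMod p₁) (p₂ - 1) u.1.2 v.1.2,
        cycForm (ZMod p₂) (p₁ - 1) u.2 v.2))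
      fun v w => by
        ext
        · simp only [Prod.fst_add, Prod.snd_add, map_add]; abel
        · simp only [Prod.snd_add, map_add])
    fun u v => by
      ext w
      · simp only [Prod.fst_add, Prod.snd_add, map_add, AddMonoidHom.add_apply,
          AddMonoidHom.mk'_apply]
        abel
      · simp only [Prod.snd_add, map_add, AddMonoidHom.add_apply, AddMonoidHom.mk'_apply]
  symm u v := by
    simp only [AddMonoidHom.mk'_apply]
    rw [cycForm_symm _ u.1.1, cycForm_symm _ u.1.2, cycForm_symm _ u.2]
  inv x u v := Prod.ext
    (congrArg₂ (· + ·) (cycForm_cycAct _ p₂ x.2 u.1.1 v.1.1) (cycForm_cycAct _ p₂ x.2 u.1.2 v.1.2))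
    (cycForm_cycAct _ p₁ x.1 u.2 v.2)

/-- The asymmetric product `T ⋊∘ H` attached to `p₁` and `p₂`. -/
abbrev AsymBrace (p₁ p₂ : ℕ) [NeZero p₁] [NeZero p₂] : Type := AsymProd (asymData p₁ p₂)

/-! Simplicity is a transfer of elements back and forth between `T` and `H`. As `b` is
nondegenerate, a nonzero ideal contains some `(0, y)` with `y ≠ 0` (`mk_zero_form_mem`,
`exists_form_ne_zero`). If `y.2 ≠ 0`, then `α y` has no nonzero fixed vector on `V₁ × V₁`, so `id -
α y` is onto there and commutators with `(0, y)` fill `V₁ × V₁`; the values of `b` then fill `ℤ/p₁`.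
A nonzero element of `ℤ/p₁` in turn yields `V₂`, hence `ℤ/p₂`. The case `y.1 ≠ 0` runs round the
same cycle from the other side.

For the orbits, the `V₁ × V₁` component of `λ_a(x)` depends on `a` only through an element of
`ℤ/p₂`. It thus takes at most `p₂` values, too few to span a space of dimension `2 (p₂ - 1)` when
`p₂ > 2`. This is why two copies of `V₁` are taken. -/

namespace AsymProd

variable {T H : Type*} [AddCommGroup T] [AddCommGroup H] {D : AsymData T H}

/-! ### Ideals of an asymmetric product. -/

theorem lam_eq (p q : AsymProd D) :
    LeftBrace.lam p q = ⟨D.α p.snd q.fst, q.snd - D.b p.fst (D.α p.snd q.fst)⟩ := by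
  have h : LeftBrace.lam p q = -p + p * q := rfl
  rw [h]
  simp only [add_def, neg_def, mul_def, map_add, map_neg, AddMonoidHom.neg_apply,
    AsymProd.mk.injEq]
  constructor <;> abel

instance [Finite T] [Finite H] : Finite (AsymProd D) :=
  Finite.of_injective (fun p : AsymProd D => (p.fst, p.snd)) fun p q h => by
    simp only [Prod.mk.injEq] at h
    exact AsymProd.ext h.1 h.2

/-- The first coordinate, as a homomorphism from the additive group of the brace. -/
def fstHom (D : AsymData T H) : AsymProd D →+ T where
  toFun p := p.fst
  map_zero' := rfl
  map_add' _ _ := rfl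

/-- An ideal contains all values `b(u, v)` for `v` a first coordinate of one of its elements. -/
theorem mk_zero_form_mem {I : Subgroup (AsymProd D)} (hI : LeftBrace.IsIdeal I)
    {q : AsymProd D} (hq : q ∈ I) (u : T) : (⟨0, D.b u q.fst⟩ : AsymProd D) ∈ I := by
  -- `λ_(-u, 0)` fixes the first coordinate and adds `b u q.fst` to the second; multiplying by `q⁻¹`
  -- isolates that increment.
  have h := I.mul_mem (I.inv_mem hq) (hI.2 ⟨-u, 0⟩ q hq)
  rw [lam_eq] at h
  convert h using 1
  simp [mul_def, inv_def]

/-- An ideal containing `(0, y)` contains `(u - α(y)(u), 0)` for every `u`. -/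
theorem mk_sub_act_mem {I : Subgroup (AsymProd D)} (hI : LeftBrace.IsIdeal I)
    {y : H} (hy : (⟨0, y⟩ : AsymProd D) ∈ I) (u : T) :
    (⟨u - D.α y u, 0⟩ : AsymProd D) ∈ I := by
  -- This is the commutator of `(u, 0)` and `(0, y)`.
  have h := I.mul_mem (hI.1.conj_mem _ hy ⟨u, 0⟩) (I.inv_mem hy)
  convert h using 1
  simp [mul_def, inv_def, sub_eq_add_neg]

theorem mk_mem {I : Subgroup (AsymProd D)} {u : T} {x : H}
    (hu : (⟨u, 0⟩ : AsymProd D) ∈ I) (hx : (⟨0, x⟩ : AsymProd D) ∈ I) :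
    (⟨u, x⟩ : AsymProd D) ∈ I := by
  convert I.mul_mem hu hx using 1
  simp [mul_def]

theorem mk_add_zero_mem {I : Subgroup (AsymProd D)} {u v : T}
    (hu : (⟨u, 0⟩ : AsymProd D) ∈ I) (hv : (⟨v, 0⟩ : AsymProd D) ∈ I) :
    (⟨u + v, 0⟩ : AsymProd D) ∈ I := by
  convert I.mul_mem hu hv using 1
  simp [mul_def]

theorem mk_zero_add_mem {I : Subgroup (AsymProd D)} {x y : H}
    (hx : (⟨0, x⟩ : AsymProd D) ∈ I) (hy : (⟨0, y⟩ : AsymProd D) ∈ I) :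
    (⟨0, x + y⟩ : AsymProd D) ∈ I := by
  convert I.mul_mem hx hy using 1
  simp [mul_def]

end AsymProd

/-! ### Fixed vectors of the action and nondegeneracy of the form. -/

section Matrices

/-- `1` is not an eigenvalue of the companion matrix of `1 + t + ⋯ + t ^ n` when `n + 1` is
nonzero in the field. -/
theorem eq_zero_of_cMat_mulVec_eq {n : ℕ} {F : Type*} [Field F] (hn : ((n : F) + 1) ≠ 0)
    {u : Fin n → F} (h : cMat n F *ᵥ u = u) : u = 0 := by
  rcases n with _ | n
  · exact Subsingleton.elim _ _
  -- The size is now `n + 1`. Each row of `C u = u` gives an entry as the previous one minus the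
  -- last; at `k = n` this forces `(n + 2) u_n = 0`.
  have key : ∀ k (hk : k < n + 1), u ⟨k, hk⟩ = -((k : F) + 1) * u ⟨n, by omega⟩ := by
    intro k
    induction k with
    | zero =>
      intro hk
      have := congrFun h ⟨0, hk⟩
      rw [cMat_mulVec] at this
      simpa using this.symm
    | succ k ih =>
      intro hk
      have := congrFun h ⟨k + 1, hk⟩
      rw [cMat_mulVec] at this
      simp only [Nat.add_eq_zero_iff, one_ne_zero, and_false, dite_false,
        Nat.add_sub_cancel] at this
      rw [← this, ih (by omega)]
      push_cast
      ring
  have hz : u ⟨n, by omega⟩ = 0 := by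
    have h1 := key n (by omega)
    have h2 : (((n + 1 : ℕ) : F) + 1) * u ⟨n, by omega⟩ = 0 := by
      push_cast
      linear_combination h1
    exact (mul_eq_zero.1 h2).resolve_left hn
  ext ⟨k, hk⟩
  rw [key k hk, hz, mul_zero, Pi.zero_apply]

variable {p q : ℕ} [Fact p.Prime] [Fact q.Prime]

theorem ZMod.natCast_prime_ne_zero (hpq : p ≠ q) : ((q : ZMod p)) ≠ 0 := by
  rw [Ne, ZMod.natCast_eq_zero_iff, Nat.prime_dvd_prime_iff_eq Fact.out Fact.out]
  exact hpq

theorem ZMod.natCast_pred_add_one_ne_zero (hpq : p ≠ q) : (((q - 1 : ℕ) : ZMod p) + 1) ≠ 0 := by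
  have h : 1 ≤ q := (Fact.out : q.Prime).one_le
  rw [← Nat.cast_add_one, Nat.sub_add_cancel h]
  exact ZMod.natCast_prime_ne_zero hpq

/-- A vector fixed by `x` is fixed by all multiples of `x`, among them the generator `1`, which acts
by the companion matrix itself. -/
theorem eq_zero_of_cycAct_eq (hpq : p ≠ q) {x : ZMod q} (hx : x ≠ 0) {u : Fin (q - 1) → ZMod p}
    (h : cycAct (ZMod p) q x u = u) : u = 0 := by
  have hmul : ∀ m : ℕ, cycAct (ZMod p) q (m * x) u = u := by
    intro m
    induction m with
    | zero => simp
    | succ m ih =>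
      rw [Nat.cast_succ, add_mul, one_mul, map_add, AddAut.add_apply, h, ih]
  have h1 : cycAct (ZMod p) q 1 u = u := by
    have := hmul (x⁻¹).val
    rwa [ZMod.natCast_zmod_val, inv_mul_cancel₀ hx] at this
  have : Fact (1 < q) := ⟨(Fact.out : q.Prime).one_lt⟩
  have h2 : u ᵥ* (cMat (q - 1) (ZMod p) ^ (1 : ZMod q).val)ᵀ = u := h1
  rw [ZMod.val_one, pow_one, Matrix.vecMul_transpose] at h2
  exact eq_zero_of_cMat_mulVec_eq (ZMod.natCast_pred_add_one_ne_zero hpq) h2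

theorem exists_sub_cycAct_eq (hpq : p ≠ q) {x : ZMod q} (hx : x ≠ 0) (w : Fin (q - 1) → ZMod p) :
    ∃ u, u - cycAct (ZMod p) q x u = w := by
  let f : (Fin (q - 1) → ZMod p) →+ (Fin (q - 1) → ZMod p) :=
    AddMonoidHom.id _ - (cycAct (ZMod p) q x).toAddMonoidHom
  have hf : Function.Injective f := by
    rw [injective_iff_map_eq_zero]
    intro u hu
    exact eq_zero_of_cycAct_eq hpq hx (sub_eq_zero.1 hu).symm
  exact Finite.surjective_of_injective hf w

/-- The matrix is `J - (n + 1)`, with `J` the all-ones matrix. A vector in its kernel has all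
entries equal to some `c`, and then `n c = (n + 1) c`. -/
theorem eq_zero_of_cycForm_eq_zero {n : ℕ} {F : Type*} [Field F] (hn : ((n : F) + 1) ≠ 0)
    {v : Fin n → F} (h : ∀ u, cycForm F n u v = 0) : v = 0 := by
  have hrow : ∀ i, ∑ j, v j = ((n : F) + 1) * v i := by
    intro i
    have h1 := h (Pi.single i 1)
    rw [cycForm_apply, ← Matrix.dotProduct_mulVec, single_one_dotProduct, Matrix.mulVec,
      dotProduct] at h1
    have key : ∀ j : Fin n, bMat n F i j * v j
        = v j - (if i = j then ((n : F) + 1) * v j else 0) := by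
      intro j
      simp only [bMat, Matrix.of_apply]
      split_ifs <;> ring
    rw [Finset.sum_congr rfl fun j _ => key j, Finset.sum_sub_distrib] at h1
    simpa [sub_eq_zero] using h1
  ext i
  have hc : ∀ j, v j = v i := fun j => mul_left_cancel₀ hn ((hrow j).symm.trans (hrow i))
  have hs : ∑ j, v j = (n : F) * v i := by
    rw [Finset.sum_congr rfl fun j _ => hc j]
    simp
  have := hrow i
  rw [hs] at this
  rw [Pi.zero_apply]
  linear_combination -this

theorem exists_cycForm_eq {n : ℕ} {F : Type*} [Field F] (hn : ((n : F) + 1) ≠ 0)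
    {v : Fin n → F} (hv : v ≠ 0) (c : F) : ∃ u, cycForm F n u v = c := by
  obtain ⟨u, hu⟩ : ∃ u, cycForm F n u v ≠ 0 := by
    by_contra! h
    exact hv (eq_zero_of_cycForm_eq_zero hn h)
  refine ⟨(c / cycForm F n u v) • u, ?_⟩
  rw [cycForm_apply, Matrix.smul_vecMul, smul_dotProduct, ← cycForm_apply, smul_eq_mul,
    div_mul_cancel₀ _ hu]

end Matrices

/-! ### Simplicity and lambda orbits of the brace. -/

namespace AsymBrace

variable {p₁ p₂ : ℕ} [Fact p₁.Prime] [Fact p₂.Prime]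

theorem act_apply (x : HGroup p₁ p₂) (u : TGroup p₁ p₂) :
    (asymData p₁ p₂).α x u = ((cycAct (ZMod p₁) p₂ x.2 u.1.1, cycAct (ZMod p₁) p₂ x.2 u.1.2),
      cycAct (ZMod p₂) p₁ x.1 u.2) := rfl

theorem form_apply (u v : TGroup p₁ p₂) :
    (asymData p₁ p₂).b u v =
      (cycForm (ZMod p₁) (p₂ - 1) u.1.1 v.1.1 + cycForm (ZMod p₁) (p₂ - 1) u.1.2 v.1.2,
        cycForm (ZMod p₂) (p₁ - 1) u.2 v.2) := rfl

theorem exists_ne_zero_pi {p q : ℕ} [Fact p.Prime] [Fact q.Prime] :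
    ∃ w : Fin (q - 1) → ZMod p, w ≠ 0 := by
  have : 0 < q - 1 := Nat.sub_pos_of_lt (Fact.out : q.Prime).one_lt
  have : Nonempty (Fin (q - 1)) := ⟨⟨0, this⟩⟩
  exact exists_ne 0

variable {I : Subgroup (AsymBrace p₁ p₂)}

theorem mk_left_mem (hp : p₁ ≠ p₂) (hI : LeftBrace.IsIdeal I) {y : HGroup p₁ p₂} (hy : y.2 ≠ 0)
    (hmem : (⟨0, y⟩ : AsymBrace p₁ p₂) ∈ I)
    (w : (Fin (p₂ - 1) → ZMod p₁) × (Fin (p₂ - 1) → ZMod p₁)) :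
    (⟨(w, 0), 0⟩ : AsymBrace p₁ p₂) ∈ I := by
  obtain ⟨u, hu⟩ := exists_sub_cycAct_eq hp hy w.1
  obtain ⟨v, hv⟩ := exists_sub_cycAct_eq hp hy w.2
  convert AsymProd.mk_sub_act_mem hI hmem ((u, v), 0) using 2
  rw [act_apply]
  simp [hu, hv]

theorem mk_right_mem (hp : p₁ ≠ p₂) (hI : LeftBrace.IsIdeal I) {y : HGroup p₁ p₂} (hy : y.1 ≠ 0)
    (hmem : (⟨0, y⟩ : AsymBrace p₁ p₂) ∈ I) (w : Fin (p₁ - 1) → ZMod p₂) :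
    (⟨(0, w), 0⟩ : AsymBrace p₁ p₂) ∈ I := by
  obtain ⟨u, hu⟩ := exists_sub_cycAct_eq hp.symm hy w
  convert AsymProd.mk_sub_act_mem hI hmem (0, u) using 2
  rw [act_apply]
  simp [hu, Prod.ext_iff]

theorem mk_zero_left_mem (hp : p₁ ≠ p₂) (hI : LeftBrace.IsIdeal I)
    (h : ∀ w, (⟨(w, 0), 0⟩ : AsymBrace p₁ p₂) ∈ I) (c : ZMod p₁) :
    (⟨0, (c, 0)⟩ : AsymBrace p₁ p₂) ∈ I := by
  obtain ⟨w, hw⟩ := exists_ne_zero_pi (p := p₁) (q := p₂)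
  obtain ⟨u, hu⟩ := exists_cycForm_eq (ZMod.natCast_pred_add_one_ne_zero hp) hw c
  convert AsymProd.mk_zero_form_mem hI (h (w, 0)) ((u, 0), 0) using 2
  rw [form_apply]
  simp [hu]

theorem mk_zero_right_mem (hp : p₁ ≠ p₂) (hI : LeftBrace.IsIdeal I)
    (h : ∀ w, (⟨(0, w), 0⟩ : AsymBrace p₁ p₂) ∈ I) (c : ZMod p₂) :
    (⟨0, (0, c)⟩ : AsymBrace p₁ p₂) ∈ I := by
  obtain ⟨w, hw⟩ := exists_ne_zero_pi (p := p₂) (q := p₁)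
  obtain ⟨u, hu⟩ := exists_cycForm_eq (ZMod.natCast_pred_add_one_ne_zero hp.symm) hw c
  convert AsymProd.mk_zero_form_mem hI (h w) (0, u) using 2
  rw [form_apply]
  simp [hu]

theorem eq_top_of_mk_zero_mem (hp : p₁ ≠ p₂) (hI : LeftBrace.IsIdeal I) {y : HGroup p₁ p₂}
    (hy : y ≠ 0) (hmem : (⟨0, y⟩ : AsymBrace p₁ p₂) ∈ I) : I = ⊤ := by
  obtain ⟨hl, hr⟩ : (∀ w, (⟨(w, 0), 0⟩ : AsymBrace p₁ p₂) ∈ I) ∧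
      ∀ w, (⟨(0, w), 0⟩ : AsymBrace p₁ p₂) ∈ I := by
    -- Either nonzero component of `y` produces its part of `T`, whose form values include a `1` in
    -- the other factor of `H`, which produces the remaining part.
    by_cases h2 : y.2 = 0
    · have h1 : y.1 ≠ 0 := fun h1 => hy (Prod.ext h1 h2)
      have hr := mk_right_mem hp hI h1 hmem
      exact ⟨mk_left_mem hp hI one_ne_zero (mk_zero_right_mem hp hI hr 1), hr⟩
    · have hl := mk_left_mem hp hI h2 hmem
      exact ⟨hl, mk_right_mem hp hI one_ne_zero (mk_zero_left_mem hp hI hl 1)⟩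
  refine (Subgroup.eq_top_iff' I).2 fun ⟨u, x⟩ => AsymProd.mk_mem ?_ ?_
  · simpa using AsymProd.mk_add_zero_mem (hl u.1) (hr u.2)
  · simpa using AsymProd.mk_zero_add_mem (mk_zero_left_mem hp hI hl x.1)
      (mk_zero_right_mem hp hI hr x.2)

theorem exists_form_ne_zero (hp : p₁ ≠ p₂) {v : TGroup p₁ p₂} (hv : v ≠ 0) :
    ∃ u, (asymData p₁ p₂).b u v ≠ 0 := by
  by_contra! h
  apply hv
  have h1 := ZMod.natCast_pred_add_one_ne_zero hp
  have h2 := ZMod.natCast_pred_add_one_ne_zero hp.symm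
  refine Prod.ext (Prod.ext ?_ ?_) ?_
  · exact eq_zero_of_cycForm_eq_zero h1 fun u => by
      simpa [form_apply] using congrArg Prod.fst (h ((u, 0), 0))
  · exact eq_zero_of_cycForm_eq_zero h1 fun u => by
      simpa [form_apply] using congrArg Prod.fst (h ((0, u), 0))
  · exact eq_zero_of_cycForm_eq_zero h2 fun u => by
      simpa [form_apply] using congrArg Prod.snd (h (0, u))

theorem isSimple (hp : p₁ ≠ p₂) : LeftBrace.IsSimple (AsymBrace p₁ p₂) := by
  refine ⟨⟨⟨0, 0⟩, ⟨0, 1⟩, fun h => ?_⟩, fun I hI => or_iff_not_imp_left.2 fun hne => ?_⟩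
  · exact zero_ne_one (congrArg AsymProd.snd h)
  · obtain ⟨q, hq, hq1⟩ := (Subgroup.bot_or_exists_ne_one I).resolve_left hne
    by_cases hv : q.fst = 0
    · have e : q = ⟨0, q.snd⟩ := AsymProd.ext hv rfl
      refine eq_top_of_mk_zero_mem hp hI (fun h0 => hq1 ?_) (e ▸ hq)
      exact AsymProd.ext hv h0
    · obtain ⟨u, hu⟩ := exists_form_ne_zero hp hv
      exact eq_top_of_mk_zero_mem hp hI hu (AsymProd.mk_zero_form_mem hI hq u)

/-- The first coordinates in the lambda orbit of an element span a subspace of `V₁ × V₁` of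
dimension at most `p₂ < 2 (p₂ - 1)`. -/
theorem closure_orbit_ne_top (hp : 2 < p₂) (x : AsymBrace p₁ p₂) :
    AddSubgroup.closure (LeftBrace.orbit x) ≠ ⊤ := by
  intro htop
  let V := Fin (p₂ - 1) → ZMod p₁
  -- Only `a.snd.2` acts on `V × V`, so `g` lists every value of this component on the orbit.
  let g : ZMod p₂ → V × V := fun k =>
    (cycAct (ZMod p₁) p₂ k x.fst.1.1, cycAct (ZMod p₁) p₂ k x.fst.1.2)
  let S : Submodule (ZMod p₁) (V × V) := Submodule.span (ZMod p₁) (Set.range g)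
  let π : AsymBrace p₁ p₂ →+ V × V := (AddMonoidHom.fst _ _).comp (AsymProd.fstHom _)
  have hle : AddSubgroup.closure (LeftBrace.orbit x) ≤ S.toAddSubgroup.comap π := by
    rw [AddSubgroup.closure_le]
    rintro _ ⟨a, rfl⟩
    rw [AsymProd.lam_eq]
    exact Submodule.subset_span ⟨a.snd.2, rfl⟩
  have hS : S = ⊤ := by
    rw [eq_top_iff]
    intro w _
    exact (htop ▸ hle) (AddSubgroup.mem_top (⟨(w, 0), 0⟩ : AsymBrace p₁ p₂))
  have h1 : Module.finrank (ZMod p₁) S ≤ Fintype.card (ZMod p₂) := finrank_range_le_card g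
  -- The bound becomes `2 (p₂ - 1) ≤ p₂`, which contradicts `2 < p₂`.
  rw [hS, finrank_top, Module.finrank_prod, Module.finrank_fin_fun, ZMod.card] at h1
  omega

end AsymBrace

theorem mainTheorem9 :
    (∃ (B : Type) (_ : LeftBrace B), Finite B ∧ LeftBrace.IsSimple B ∧
      ∀ x : B, AddSubgroup.closure (LeftBrace.orbit x) ≠ ⊤) ∧
    ∀ (p₁ p₂ : ℕ) [Fact p₁.Prime] [Fact p₂.Prime], p₁ ≠ p₂ → 2 < p₂ →
      Finite (AsymBrace p₁ p₂) ∧ LeftBrace.IsSimple (AsymBrace p₁ p₂) ∧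
      ∀ x : AsymBrace p₁ p₂, AddSubgroup.closure (LeftBrace.orbit x) ≠ ⊤ := by
  have main : ∀ (p₁ p₂ : ℕ) [Fact p₁.Prime] [Fact p₂.Prime], p₁ ≠ p₂ → 2 < p₂ →
      Finite (AsymBrace p₁ p₂) ∧ LeftBrace.IsSimple (AsymBrace p₁ p₂) ∧
      ∀ x : AsymBrace p₁ p₂, AddSubgroup.closure (LeftBrace.orbit x) ≠ ⊤ :=
    fun p₁ p₂ _ _ hne hlt =>
      ⟨inferInstance, AsymBrace.isSimple hne, AsymBrace.closure_orbit_ne_top hlt⟩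
  exact ⟨⟨AsymBrace 2 3, inferInstance, main 2 3 (by decide) (by decide)⟩, main⟩
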